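/- Let $P\ge 1$. For $\delta>0$, $M\ge 1$ and $\mu_1,\dots,\mu_P\ge 0$, let $\mathbf X_1,\dots,\mathbf X_M$ be independent and identically distributed $P$-dimensional random vectors, where each $\mathbf X_m=(X_{m,1},\dots,X_{m,P})^T$ has independent components $X_{m,i}\sim\delta\,\mathrm{Pois}(\mu_i)$ (that is, $X_{m,i}/\delta$ is Poisson with mean $\mu_i$). Let $\mathcal L(\mathbb X;\mu_1,\dots,\mu_P)=\prod_{m=1}^M\prod_{i=1}^P \Pr\left(\delta\,\mathrm{Pois}(\mu_i)=X_{m,i}\right)$ denote the likelihood of the data $\mathbb X=\{\mathbf X_m\}_{m=1}^M$, and let $R=-2\log r$, where $$r=\frac{\sup_{\mu_c>0}\mathcal L(\mathbb X;\mu_c,\dots,\mu_c)}{\sup_{\mu_1,\dots,\mu_P\ge 0,\ \sum_i\mu_i>0}\mathcal L(\mathbb X;\mu_1,\dots,\mu_P)}$$ is the likelihood ratio statistic for testing $H:\mu_1=\dots=\mu_P$. Then: 1. The distribution of $R$ depends only on the products $\mu_iM$, $1\le i\le P$: two such samples, with parameters $(\delta,M,\mu_1,\dots,\mu_P)$ and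 $(\delta',M',\mu_1',\dots,\mu_P')$ satisfying $\mu_iM=\mu_i'M'$ for all $i$, give statistics $R$ and $R'$ with the same distribution. 2. Let $\delta>0$ be fixed. If $\mu_1=\dots=\mu_P=\mu_c$, then $R\overset{d}{\to}\chi^2_{P-1}$ as $\mu_cM\to\infty$, however $M\ge1$ and $\mu_c$ vary (in particular for $M=1$ fixed and $\mu_c\to\infty$), where $\chi^2_0$ is the point mass at $0$. Consequently, if $0<\alpha<1$ and $c_\alpha$ satisfies $\chi^2_{P-1}\big((c_\alpha,\infty)\big)=\alpha$, then $\Pr(R>c_\alpha)\to\alpha$ as $\mu_cM\to\infty$, so the test that rejects $H$ when $R>c_\alpha$ has asymptotic level $\alpha$, even for a single realization ($M=1$). -/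

import Mathlib

open MeasureTheory ProbabilityTheory Filter Topology
open scoped NNReal

/-- The law `δ · Pois(μ)` on `ℝ`: the law of `δ * N` with `N` Poisson of mean `μ`. -/
noncomputable def scaledPoisson (δ : ℝ) (μ : ℝ≥0) : Measure ℝ :=
  (poissonMeasure μ).map (fun n : ℕ => δ * (n : ℝ))

/-- The likelihood `L(x; μ₁, …, μ_P)` of data `x = (x m i)`: the product over all observations
of the probability mass that `δ · Pois(μ i)` gives to the observed value `x m i`. -/
noncomputable def likelihood {M P : ℕ} (δ : ℝ) (x : Fin M → Fin P → ℝ) (μ : Fin P → ℝ≥0) : ℝ :=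
  ∏ m, ∏ i, (scaledPoisson δ (μ i)).real {x m i}

/-- The likelihood ratio `r`: the supremum of the likelihood over `μ₁ = ⋯ = μ_P = c > 0`, divided
by its supremum over all `(μ₁, …, μ_P)` with `μ i ≥ 0` and `∑ μ i > 0`.
Likelihoods lie in `[0, 1]`, so the real suprema are over bounded sets. -/
noncomputable def likelihoodRatio {M P : ℕ} (δ : ℝ) (x : Fin M → Fin P → ℝ) : ℝ :=
  (⨆ c : {c : ℝ≥0 // 0 < c}, likelihood δ x (fun _ => (c : ℝ≥0))) /
    (⨆ μ : {μ : Fin P → ℝ≥0 // 0 < ∑ i, μ i}, likelihood δ x (μ : Fin P → ℝ≥0))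

/-- The test statistic `R = -2 log r`. -/
noncomputable def lrtStat {M P : ℕ} (δ : ℝ) (x : Fin M → Fin P → ℝ) : ℝ :=
  -2 * Real.log (likelihoodRatio δ x)

/-- `X 0, …, X (M-1)` are independent `P`-dimensional random vectors, each with independent
components, the `i`-th one of law `δ · Pois(μ i)`. (The law of a vector is then the product of the
laws of its components, so that the vectors are identically distributed.) -/
structure IsScaledPoissonSample {Ω : Type*} [MeasurableSpace Ω] (ν : Measure Ω) {M P : ℕ}
    (δ : ℝ) (μ : Fin P → ℝ≥0) (X : Fin M → Ω → Fin P → ℝ) : Prop where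
  indep_vectors : iIndepFun X ν
  indep_components : ∀ m, iIndepFun (fun (i : Fin P) (ω : Ω) => X m ω i) ν
  law : ∀ m i, HasLaw (fun ω => X m ω i) (scaledPoisson δ (μ i)) ν

/-- The `χ²` distribution with `k` degrees of freedom: the law of `∑ i < k, Z i ^ 2` with
independent standard normal `Z i`. For `k = 0` this is the point mass at `0`. -/
noncomputable def chiSquared (k : ℕ) : Measure ℝ :=
  (Measure.pi (fun _ : Fin k => gaussianReal 0 1)).map (fun z => ∑ i, z i ^ 2)

instance chiSquared_isProbabilityMeasure (k : ℕ) : IsProbabilityMeasure (chiSquared k) :=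
  Measure.isProbabilityMeasure_map (Measurable.aemeasurable (by fun_prop))

/-! ### The likelihood ratio statistic as a function of the column sums -/

/-! The likelihood depends on the means only through the column sums `S i` of the counts, and its
two suprema are the values at `S i / M` and at `(∑ S i) / (M P)`. In the ratio the factorials, the
exponentials and `M` cancel, so almost surely `R = countStat S` (`lrtStat_eq_countStat`). The `S i`
are independent Poisson variables of means `μ i * M` (`hasLaw_sum_div`), which gives the first
claim.

Under the null hypothesis put `r = μc * M` and `Z i = (S i - r) / √r`. Then `R` is exactly a fixed,
jointly continuous function of `(Z, 1 / √r)`, equal to `∑ Z i ^ 2 - (∑ Z i) ^ 2 / P` when the last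
argument is `0`. By the Poisson central limit theorem `(Z, 1 / √r)` converges in law to a standard
Gaussian vector paired with `0`; continuous mapping yields that quadratic form in the limit, which
is `χ²` by rotation invariance. The level statement is the portmanteau theorem, as `χ²` has no atoms
in positive dimension. -/

/-- The likelihood ratio statistic as a function of the total counts `s i`. -/
noncomputable def countStat {P : ℕ} (s : Fin P → ℝ) : ℝ :=
  2 * (∑ i, s i * Real.log (s i) - (∑ i, s i) * Real.log (∑ i, s i) + (∑ i, s i) * Real.log P)

lemma measurable_countStat {P : ℕ} : Measurable (countStat (P := P)) := by
  unfold countStat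
  fun_prop

/-- The function `exp (-a) * a ^ n` peaks at `a = n`; this is `1 + x ≤ exp x` at `x = a / n - 1`,
raised to the power `n`. -/
lemma exp_neg_mul_pow_le (n : ℕ) {a : ℝ} (ha : 0 ≤ a) :
    Real.exp (-a) * a ^ n ≤ Real.exp (-n) * (n : ℝ) ^ n := by
  rcases Nat.eq_zero_or_pos n with rfl | hn
  · simpa using ha
  have hn' : (0 : ℝ) < n := by exact_mod_cast hn
  have h1 : a / n ≤ Real.exp (a / n - 1) := by linarith [Real.add_one_le_exp (a / n - 1)]
  have h2 : (a / n) ^ n ≤ Real.exp (a - n) := by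
    calc (a / n) ^ n ≤ Real.exp (a / n - 1) ^ n := by gcongr
      _ = Real.exp (a - n) := by
        rw [← Real.exp_nat_mul]
        congr 1
        field_simp
  rw [div_pow, div_le_iff₀ (by positivity)] at h2
  calc Real.exp (-a) * a ^ n ≤ Real.exp (-a) * (Real.exp (a - n) * (n : ℝ) ^ n) := by gcongr
    _ = Real.exp (-n) * (n : ℝ) ^ n := by
      rw [← mul_assoc, ← Real.exp_add]
      congr 2
      ring

lemma exp_neg_mul_mul_pow_le (n : ℕ) {a c : ℝ} (ha : 0 ≤ a) (hc : 0 < c) :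
    Real.exp (-(c * a)) * a ^ n ≤ Real.exp (-n) * (n / c) ^ n := by
  have h := exp_neg_mul_pow_le n (mul_nonneg hc.le ha)
  rw [div_pow, mul_div_assoc', le_div_iff₀ (by positivity)]
  calc Real.exp (-(c * a)) * a ^ n * c ^ n = Real.exp (-(c * a)) * (c * a) ^ n := by
        rw [mul_pow]; ring
    _ ≤ _ := h

lemma ciSup_eq_of_forall_le_of_tendsto {ι : Type*} {g : ι → ℝ} {B : ℝ} (hle : ∀ i, g i ≤ B)
    {u : ℕ → ι} (hu : Tendsto (fun n => g (u n)) atTop (𝓝 B)) : ⨆ i, g i = B := by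
  have : Nonempty ι := ⟨u 0⟩
  refine le_antisymm (ciSup_le hle) (le_of_tendsto' hu fun n => ?_)
  exact le_ciSup (f := g) ⟨B, by rintro _ ⟨i, rfl⟩; exact hle i⟩ (u n)

lemma scaledPoisson_real_singleton {δ : ℝ} (hδ : 0 < δ) (r : ℝ≥0) (n : ℕ) :
    (scaledPoisson δ r).real {δ * n} = Real.exp (-r) * r ^ n / n.factorial := by
  rw [scaledPoisson, map_measureReal_apply (by fun_prop) (measurableSet_singleton _),
    ← poissonMeasure_real_singleton]
  congr 1
  ext k
  simp [hδ.ne']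

lemma likelihood_eq {M P : ℕ} {δ : ℝ} (hδ : 0 < δ) (n : Fin M → Fin P → ℕ) (μ : Fin P → ℝ≥0) :
    likelihood δ (fun m i => δ * n m i) μ =
      (∏ m, ∏ i, ((n m i).factorial : ℝ)⁻¹) *
        ∏ i, (Real.exp (-(M * μ i)) * (μ i : ℝ) ^ (∑ m, n m i)) := by
  simp only [likelihood, scaledPoisson_real_singleton hδ, div_eq_mul_inv, Finset.prod_mul_distrib]
  rw [mul_comm, Finset.prod_comm (f := fun m i => Real.exp (-(μ i : ℝ))),
    Finset.prod_comm (f := fun m i => (μ i : ℝ) ^ n m i)]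
  congr 2
  · simp [← Real.exp_nat_mul]
  · simp [Finset.prod_pow_eq_pow_sum]

lemma iSup_likelihood {M P : ℕ} (hM : 1 ≤ M) (hP : 1 ≤ P) {δ : ℝ} (hδ : 0 < δ)
    (n : Fin M → Fin P → ℕ) :
    (⨆ μ : {μ : Fin P → ℝ≥0 // 0 < ∑ i, μ i}, likelihood δ (fun m i => δ * n m i) μ) =
      (∏ m, ∏ i, ((n m i).factorial : ℝ)⁻¹) *
        ∏ i, (Real.exp (-(∑ m, n m i : ℕ)) * ((∑ m, n m i : ℕ) / (M : ℝ)) ^ (∑ m, n m i)) := by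
  have hM' : (0 : ℝ) < M := by exact_mod_cast hM
  have : NeZero P := ⟨by omega⟩
  -- If all counts vanish, the maximiser is the excluded zero vector, so the supremum is only
  -- approached; the shift `1 / (k + 1)` keeps the approximating means admissible.
  refine ciSup_eq_of_forall_le_of_tendsto
    (u := fun k => ⟨fun i => ((∑ m, n m i : ℕ) : ℝ≥0) / M + 1 / (k + 1),
      Finset.sum_pos (fun i _ => by positivity) Finset.univ_nonempty⟩) ?_ ?_
  · rintro ⟨μ, hμ⟩
    rw [likelihood_eq hδ]
    gcongr ?_ * ∏ i, ?_ with i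
    exact exp_neg_mul_mul_pow_le _ (μ i).2 hM'
  · simp only [likelihood_eq hδ]
    refine tendsto_const_nhds.mul (tendsto_finsetProd _ fun i _ => ?_)
    set s := ∑ m, n m i
    have h : Tendsto (fun k : ℕ => (s : ℝ) / M + 1 / ((k : ℝ) + 1)) atTop (𝓝 (s / M)) := by
      simpa using tendsto_const_nhds.add (tendsto_one_div_add_atTop_nhds_zero_nat (𝕜 := ℝ))
    have hc : Continuous fun a : ℝ => Real.exp (-(M * a)) * a ^ s := by fun_prop
    have := (hc.tendsto _).comp h
    rw [mul_div_cancel₀ _ hM'.ne'] at this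
    refine this.congr fun k => ?_
    simp

lemma iSup_likelihood_const {M P : ℕ} (hM : 1 ≤ M) (hP : 1 ≤ P) {δ : ℝ} (hδ : 0 < δ)
    (n : Fin M → Fin P → ℕ) :
    (⨆ c : {c : ℝ≥0 // 0 < c}, likelihood δ (fun m i => δ * n m i) (fun _ => (c : ℝ≥0))) =
      (∏ m, ∏ i, ((n m i).factorial : ℝ)⁻¹) *
        (Real.exp (-(∑ i, ∑ m, n m i : ℕ)) *
          ((∑ i, ∑ m, n m i : ℕ) / (M * P : ℝ)) ^ (∑ i, ∑ m, n m i)) := by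
  have hM' : (0 : ℝ) < M := by exact_mod_cast hM
  have hP' : (0 : ℝ) < P := by exact_mod_cast hP
  set s := ∑ i, ∑ m, n m i with hs
  have hl (c : ℝ≥0) : likelihood δ (fun m i => δ * n m i) (fun _ => c) =
      (∏ m, ∏ i, ((n m i).factorial : ℝ)⁻¹) *
        (Real.exp (-((M * P : ℝ) * c)) * (c : ℝ) ^ s) := by
    rw [likelihood_eq hδ, Finset.prod_mul_distrib, Finset.prod_pow_eq_pow_sum, ← hs,
      ← Real.exp_sum]
    simp only [Finset.sum_const, Finset.card_univ, Fintype.card_fin, nsmul_eq_mul]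
    congr 3
    ring
  refine ciSup_eq_of_forall_le_of_tendsto
    (u := fun k => ⟨(s : ℝ≥0) / (M * P) + 1 / (k + 1), by positivity⟩) ?_ ?_
  · rintro ⟨c, hc⟩
    rw [hl]
    gcongr ?_ * ?_
    exact exp_neg_mul_mul_pow_le _ c.2 (by positivity)
  · simp only [hl]
    refine tendsto_const_nhds.mul ?_
    have h : Tendsto (fun k : ℕ => (s : ℝ) / (M * P) + 1 / ((k : ℝ) + 1)) atTop
        (𝓝 (s / (M * P))) := by
      simpa using tendsto_const_nhds.add (tendsto_one_div_add_atTop_nhds_zero_nat (𝕜 := ℝ))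
    have hc : Continuous fun a : ℝ => Real.exp (-((M * P : ℝ) * a)) * a ^ s := by fun_prop
    have := (hc.tendsto _).comp h
    rw [mul_div_cancel₀ _ (by positivity)] at this
    refine this.congr fun k => ?_
    simp

lemma natCast_div_pow_self_pos (n : ℕ) {c : ℝ} (hc : 0 < c) : 0 < ((n : ℝ) / c) ^ n := by
  rcases Nat.eq_zero_or_pos n with rfl | hn
  · simp
  · positivity

lemma log_exp_neg_mul_div_pow (n : ℕ) {c : ℝ} (hc : 0 < c) :
    Real.log (Real.exp (-n) * ((n : ℝ) / c) ^ n) = -n + n * Real.log n - n * Real.log c := by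
  rw [Real.log_mul (Real.exp_pos _).ne' (natCast_div_pow_self_pos n hc).ne', Real.log_exp,
    Real.log_pow]
  rcases Nat.eq_zero_or_pos n with rfl | hn
  · simp
  · rw [Real.log_div (by positivity) hc.ne']
    ring

/-- All-zero data are covered too, through `0 ^ 0 = 1` and `0 * log 0 = 0`. -/
lemma lrtStat_eq_countStat {M P : ℕ} (hM : 1 ≤ M) (hP : 1 ≤ P) {δ : ℝ} (hδ : 0 < δ)
    (n : Fin M → Fin P → ℕ) :
    lrtStat δ (fun m i => δ * n m i) = countStat (fun i => ∑ m, (n m i : ℝ)) := by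
  have hM' : (0 : ℝ) < M := by exact_mod_cast hM
  have hP' : (0 : ℝ) < P := by exact_mod_cast hP
  have hC : (∏ m, ∏ i, ((n m i).factorial : ℝ)⁻¹) ≠ 0 :=
    Finset.prod_ne_zero_iff.2 fun m _ => Finset.prod_ne_zero_iff.2 fun i _ => by positivity
  have hpos (k : ℕ) {c : ℝ} (hc : 0 < c) : Real.exp (-k) * ((k : ℝ) / c) ^ k ≠ 0 :=
    (mul_pos (Real.exp_pos _) (natCast_div_pow_self_pos k hc)).ne'
  rw [lrtStat, likelihoodRatio, iSup_likelihood hM hP hδ, iSup_likelihood_const hM hP hδ,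
    mul_div_mul_left _ _ hC,
    Real.log_div (hpos _ (by positivity)) (Finset.prod_ne_zero_iff.2 fun i _ => hpos _ hM'),
    Real.log_prod (fun i _ => hpos _ hM'), log_exp_neg_mul_div_pow _ (by positivity),
    Finset.sum_congr rfl fun i _ => log_exp_neg_mul_div_pow _ hM',
    Real.log_mul hM'.ne' hP'.ne', Finset.sum_sub_distrib, Finset.sum_add_distrib,
    Finset.sum_neg_distrib, ← Finset.sum_mul, countStat]
  push_cast
  ring

/-! ### The law of the column sums -/

/-- The Poisson distribution of mean `r`, as a measure on `ℝ`. -/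
noncomputable def poissonReal (r : ℝ≥0) : Measure ℝ :=
  (poissonMeasure r).map (fun n : ℕ => (n : ℝ))

instance isProbabilityMeasure_poissonReal (r : ℝ≥0) : IsProbabilityMeasure (poissonReal r) :=
  Measure.isProbabilityMeasure_map (Measurable.aemeasurable (by fun_prop))

lemma charFun_poissonReal (r : ℝ≥0) (t : ℝ) :
    charFun (poissonReal r) t =
      Complex.exp (r * (Complex.exp (t * Complex.I) - 1)) :=
  charFun_map_cast_poissonMeasure r t

lemma charFunDual_poissonReal (r : ℝ≥0) (L : StrongDual ℝ ℝ) :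
    charFunDual (poissonReal r) L =
      Complex.exp (r * (Complex.exp (L 1 * Complex.I) - 1)) := by
  rw [← charFun_poissonReal, charFunDual_apply, charFun_apply_real]
  congr with x
  have : L x = x * L 1 := by simpa using L.map_smul x (1 : ℝ)
  rw [this]
  push_cast
  ring_nf

lemma map_div_scaledPoisson {δ : ℝ} (hδ : 0 < δ) (r : ℝ≥0) :
    (scaledPoisson δ r).map (fun x => x / δ) = poissonReal r := by
  rw [scaledPoisson, Measure.map_map (by fun_prop) (by fun_prop), poissonReal]
  congr 1
  ext n
  simp [hδ.ne']

lemma ae_scaledPoisson {δ : ℝ} (r : ℝ≥0) :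
    ∀ᵐ x ∂(scaledPoisson δ r), ∃ n : ℕ, x = δ * n := by
  have hs : MeasurableSet {x : ℝ | ∃ n : ℕ, x = δ * n} := by
    have : {x : ℝ | ∃ n : ℕ, x = δ * n} = Set.range fun n : ℕ => δ * (n : ℝ) := by
      ext x
      simp [eq_comm]
    rw [this]
    exact (Set.countable_range _).measurableSet
  rw [scaledPoisson, ae_map_iff (Measurable.aemeasurable (by fun_prop)) hs]
  exact ae_of_all _ fun n => ⟨n, rfl⟩

namespace IsScaledPoissonSample

variable {Ω : Type*} [MeasurableSpace Ω] {ν : Measure Ω} [IsProbabilityMeasure ν] {M P : ℕ}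
  {δ : ℝ} {μ : Fin P → ℝ≥0} {X : Fin M → Ω → Fin P → ℝ}

lemma hasLaw_sum_div (h : IsScaledPoissonSample ν δ μ X) (hδ : 0 < δ) :
    HasLaw (fun ω i => ∑ m, X m ω i / δ)
      (Measure.pi fun i => poissonReal (μ i * (M : ℝ≥0))) ν := by
  have hX (m : Fin M) (i : Fin P) : AEMeasurable (fun ω => X m ω i) ν := (h.law m i).aemeasurable
  have hY (m : Fin M) : AEMeasurable (fun ω i => X m ω i / δ) ν :=
    aemeasurable_pi_lambda _ fun i => (hX m i).div_const δ
  have hT : AEMeasurable (fun ω i => ∑ m, X m ω i / δ) ν :=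
    aemeasurable_pi_lambda _ fun i =>
      Finset.aemeasurable_fun_sum _ fun m _ => (hX m i).div_const δ
  have hind : iIndepFun (fun m ω (i : Fin P) => X m ω i / δ) ν :=
    h.indep_vectors.comp (fun _ x i => x i / δ) fun _ => by fun_prop
  have hYlaw (m : Fin M) : ν.map (fun ω i => X m ω i / δ) =
      Measure.pi fun i => poissonReal (μ i) := by
    have hc : iIndepFun (fun i ω => X m ω i / δ) ν :=
      (h.indep_components m).comp (fun _ x => x / δ) fun _ => by fun_prop
    rw [hc.map_fun_eq_pi_map fun i => (hX m i).div_const δ]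
    congr with i : 1
    rw [← map_div_scaledPoisson hδ, ← (h.law m i).map_eq,
      AEMeasurable.map_map_of_aemeasurable (by fun_prop) (hX m i)]
    rfl
  refine ⟨hT, ?_⟩
  have := Measure.isProbabilityMeasure_map (μ := ν) hT
  rw [← charFunDual_eq_pi_iff]
  intro L
  have hsum : (fun ω i => ∑ m, X m ω i / δ) = fun ω => ∑ m, fun i => X m ω i / δ := by
    ext ω i
    simp
  rw [hsum, hind.charFunDual_map_fun_sum_eq_prod hY]
  simp only [hYlaw, charFunDual_pi, charFunDual_poissonReal, Finset.prod_const, Finset.card_univ,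
    Fintype.card_fin, Pi.pow_apply, ← Finset.prod_pow, ← Complex.exp_nat_mul]
  refine Finset.prod_congr rfl fun i _ => ?_
  push_cast
  ring_nf

lemma hasLaw_lrtStat (h : IsScaledPoissonSample ν δ μ X) (hδ : 0 < δ) (hM : 1 ≤ M) (hP : 1 ≤ P) :
    HasLaw (fun ω => lrtStat δ (fun m => X m ω))
      ((Measure.pi fun i => poissonReal (μ i * (M : ℝ≥0))).map countStat) ν := by
  have hG : HasLaw (countStat (P := P))
      ((Measure.pi fun i => poissonReal (μ i * (M : ℝ≥0))).map countStat)
      (Measure.pi fun i => poissonReal (μ i * (M : ℝ≥0))) :=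
    ⟨measurable_countStat.aemeasurable, rfl⟩
  refine (hG.comp (h.hasLaw_sum_div hδ)).congr ?_
  -- The closed form of the statistic is valid only for data on the lattice `δ ℕ`.
  have hae : ∀ᵐ ω ∂ν, ∀ m i, ∃ n : ℕ, X m ω i = δ * n := by
    rw [ae_all_iff]
    refine fun m => ae_all_iff.2 fun i => ?_
    refine ae_of_ae_map (p := fun x => ∃ n : ℕ, x = δ * n) (h.law m i).aemeasurable ?_
    rw [(h.law m i).map_eq]
    exact ae_scaledPoisson _
  filter_upwards [hae] with ω hω
  choose n hn using hω
  have hx : (fun m => X m ω) = fun m i => δ * (n m i : ℝ) := by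
    ext m i
    exact hn m i
  simp only [hx, lrtStat_eq_countStat hM hP hδ, Function.comp, hn]
  simp [hδ.ne']

end IsScaledPoissonSample

/-! ### The chi-squared distribution -/

/-- Extend the unit vector `w` along `(1, …, 1)` to an orthonormal basis: the form is `‖v‖ ^ 2 - ⟪w,
v⟫ ^ 2`, the sum of the other `k` squared coordinates, and these are again independent standard
Gaussians. -/
lemma map_sum_sq_sub_sq_sum_eq_chiSquared (k : ℕ) :
    (Measure.pi fun _ : Fin (k + 1) => gaussianReal 0 1).map
      (fun z : Fin (k + 1) → ℝ => ∑ i, z i ^ 2 - (∑ i, z i) ^ 2 / ((k + 1 : ℕ) : ℝ)) = chiSquared k := by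
  have hk : (0 : ℝ) < (k + 1 : ℕ) := by positivity
  set w : EuclideanSpace ℝ (Fin (k + 1)) := WithLp.toLp 2 fun _ => (√(k + 1 : ℕ))⁻¹ with hw
  have hw1 : ‖w‖ = 1 := by
    rw [← sq_eq_sq₀ (norm_nonneg _) zero_le_one, EuclideanSpace.real_norm_sq_eq]
    simp only [hw, Finset.sum_const, Finset.card_univ, Fintype.card_fin, nsmul_eq_mul, inv_pow,
      Real.sq_sqrt hk.le, one_pow]
    exact mul_inv_cancel₀ hk.ne'
  have hon : Orthonormal ℝ (({0} : Set (Fin (k + 1))).domRestrict fun _ => w) := by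
    rw [orthonormal_iff_ite]
    rintro ⟨i, rfl⟩ ⟨j, rfl⟩
    simp [hw1]
  obtain ⟨b, hb⟩ := hon.exists_orthonormalBasis_extension_of_card_eq (by simp)
  have hb0 : b 0 = w := hb 0 rfl
  have hq : Measurable fun v : EuclideanSpace ℝ (Fin (k + 1)) => ‖v‖ ^ 2 - inner ℝ (b 0) v ^ 2 := by
    fun_prop
  have h1 : (fun z : Fin (k + 1) → ℝ => ∑ i, z i ^ 2 - (∑ i, z i) ^ 2 / (k + 1 : ℕ)) =
      (fun v : EuclideanSpace ℝ (Fin (k + 1)) => ‖v‖ ^ 2 - inner ℝ (b 0) v ^ 2) ∘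
        WithLp.toLp 2 := by
    ext z
    simp only [Function.comp, EuclideanSpace.real_norm_sq_eq, hb0, hw, PiLp.inner_apply,
      Real.inner_apply, ← Finset.mul_sum, mul_pow, inv_pow, Real.sq_sqrt hk.le]
    ring
  have h2 : (fun v : EuclideanSpace ℝ (Fin (k + 1)) => ‖v‖ ^ 2 - inner ℝ (b 0) v ^ 2) ∘
      (fun x : Fin (k + 1) → ℝ => ∑ i, x i • b i) =
      (fun z : Fin k → ℝ => ∑ i, z i ^ 2) ∘ Prod.snd ∘
        MeasurableEquiv.piFinSuccAbove (fun _ => ℝ) 0 := by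
    ext x
    have hi (j : Fin (k + 1)) : inner ℝ (b j) (∑ i, x i • b i) = x j := by
      simp [inner_sum, inner_smul_right, b.inner_eq_ite]
    simp only [Function.comp, ← b.sum_sq_inner_right, hi]
    rw [Fin.sum_univ_succ, add_sub_cancel_left]
    simp [MeasurableEquiv.piFinSuccAbove, Fin.tail]
  rw [h1, ← Measure.map_map hq (by fun_prop), map_pi_eq_stdGaussian,
    stdGaussian_eq_map_pi_orthonormalBasis b, Measure.map_map hq (by fun_prop), h2,
    ← Measure.map_map (by fun_prop) (by fun_prop), ← Measure.map_map (by fun_prop) (by fun_prop),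
    (measurePreserving_piFinSuccAbove (fun _ : Fin (k + 1) => gaussianReal 0 1) 0).map_eq,
    Measure.map_snd_prod]
  simp [chiSquared]

/-- With the other coordinates fixed, at most two values of the first one reach `c`, and a Gaussian
has no atoms. -/
lemma chiSquared_succ_singleton (k : ℕ) (c : ℝ) : chiSquared (k + 1) {c} = 0 := by
  have hm : MeasurableSet {p : ℝ × (Fin k → ℝ) | p.1 ^ 2 + ∑ i, p.2 i ^ 2 = c} :=
    measurableSet_eq_fun (by fun_prop) (by fun_prop)
  have hpre : (fun z : Fin (k + 1) → ℝ => ∑ i, z i ^ 2) ⁻¹' {c} =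
      MeasurableEquiv.piFinSuccAbove (fun _ => ℝ) 0 ⁻¹'
        {p : ℝ × (Fin k → ℝ) | p.1 ^ 2 + ∑ i, p.2 i ^ 2 = c} := by
    ext z
    simp [MeasurableEquiv.piFinSuccAbove, Fin.tail, Fin.sum_univ_succ]
  rw [chiSquared, Measure.map_apply (by fun_prop) (measurableSet_singleton c), hpre,
    (measurePreserving_piFinSuccAbove (fun _ : Fin (k + 1) => gaussianReal 0 1) 0).measure_preimage
      hm.nullMeasurableSet, Measure.prod_apply_symm hm]
  have := nullSingletonClass_gaussianReal (μ := 0) (v := 1) one_ne_zero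
  refine (lintegral_congr fun y => ?_).trans lintegral_zero
  refine Set.Countable.measure_zero (Set.Finite.countable ?_) _
  refine Set.Finite.subset (Set.toFinite {√(c - ∑ i, y i ^ 2), -√(c - ∑ i, y i ^ 2)})
    fun x hx => ?_
  have hx' : c - ∑ i, y i ^ 2 = x ^ 2 := by
    have : x ^ 2 + ∑ i, y i ^ 2 = c := hx
    linarith
  rw [hx', Real.sqrt_sq_eq_abs]
  rcases abs_choice x with h | h <;> simp [h]

/-! ### The Poisson central limit theorem -/

/-- The standardized Poisson distribution: the law of `(N - r) / √r` with `N` Poisson of mean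
`r`. -/
noncomputable def standardizedPoisson (r : ℝ≥0) : ProbabilityMeasure ℝ :=
  ⟨(poissonReal r).map (fun x => (√(r : ℝ))⁻¹ * x + -√(r : ℝ)),
    Measure.isProbabilityMeasure_map (Measurable.aemeasurable (by fun_prop))⟩

lemma charFun_standardizedPoisson {r : ℝ≥0} (hr : 0 < r) (t : ℝ) :
    charFun (standardizedPoisson r : Measure ℝ) t =
      Complex.exp (r * (Complex.exp (((√(r : ℝ))⁻¹ * t : ℝ) * Complex.I) - 1 -
        ((√(r : ℝ))⁻¹ * t : ℝ) * Complex.I)) := by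
  have hs : (0 : ℝ) < √(r : ℝ) := Real.sqrt_pos.2 (by exact_mod_cast hr)
  have hcomp : (poissonReal r).map (fun x => (√(r : ℝ))⁻¹ * x + -√(r : ℝ)) =
      ((poissonReal r).map fun x => (√(r : ℝ))⁻¹ * x).map (· + -√(r : ℝ)) := by
    rw [Measure.map_map (by fun_prop) (by fun_prop)]
    rfl
  rw [standardizedPoisson, ProbabilityMeasure.coe_mk, hcomp, charFun_map_add_const,
    charFun_map_mul, charFun_poissonReal, ← Complex.exp_add]
  congr 1
  have h : (r : ℂ) * ((√(r : ℝ))⁻¹ * t : ℝ) = (√(r : ℝ) * t : ℝ) := by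
    have h' : (r : ℝ) * ((√(r : ℝ))⁻¹ * t) = √(r : ℝ) * t := by
      field_simp
      rw [Real.sq_sqrt r.coe_nonneg]
    rw [← h']
    push_cast
    rfl
  rw [mul_sub _ (_ - 1), ← mul_assoc (r : ℂ) _ Complex.I, h, Real.inner_apply]
  push_cast
  ring

lemma tendsto_exp_sub_one_sub_self_div_sq :
    Tendsto (fun z : ℂ => (Complex.exp z - 1 - z) / z ^ 2) (𝓝[≠] 0) (𝓝 (1 / 2)) := by
  rw [tendsto_iff_norm_sub_tendsto_zero]
  have hb : Tendsto (fun z : ℂ => ‖z‖) (𝓝[≠] 0) (𝓝 0) := by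
    simpa using (continuous_norm.tendsto (0 : ℂ)).mono_left nhdsWithin_le_nhds
  refine squeeze_zero' (Eventually.of_forall fun _ => norm_nonneg _) ?_ hb
  have h1 : ∀ᶠ z : ℂ in 𝓝[≠] 0, ‖z‖ ≤ 1 := (hb.eventually_lt_const one_pos).mono fun _ h => h.le
  filter_upwards [h1, self_mem_nhdsWithin] with z hz hz0
  have hz0 : z ≠ 0 := hz0
  have hzn : 0 < ‖z‖ := norm_pos_iff.2 hz0
  have hexp := Complex.exp_bound hz (n := 3) (by norm_num)
  have heq : (Complex.exp z - 1 - z) / z ^ 2 - 1 / 2 =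
      (Complex.exp z - ∑ m ∈ Finset.range 3, z ^ m / m.factorial) / z ^ 2 := by
    simp only [Finset.sum_range_succ, Finset.sum_range_zero, Nat.factorial]
    field_simp
    push_cast
    ring
  rw [heq, norm_div, norm_pow, div_le_iff₀ (by positivity)]
  refine hexp.trans ?_
  have : (0 : ℝ) ≤ ‖z‖ ^ 3 := by positivity
  norm_num [Nat.factorial]
  nlinarith

lemma tendsto_nnreal_sqrt_inv : Tendsto (fun r : ℝ≥0 => (√(r : ℝ))⁻¹) atTop (𝓝 0) :=
  tendsto_inv_atTop_zero.comp (Real.tendsto_sqrt_atTop.comp (NNReal.tendsto_coe_atTop.2 tendsto_id))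

/-- The exponent is `r * (exp z - 1 - z)` with `z = i t / √r`; since `r * z ^ 2 = -t ^ 2`, it tends
to `-t ^ 2 / 2`. -/
lemma tendsto_charFun_standardizedPoisson (t : ℝ) :
    Tendsto (fun r => charFun (standardizedPoisson r : Measure ℝ) t) atTop
      (𝓝 (charFun (gaussianReal 0 1) t)) := by
  have hpos : ∀ᶠ r : ℝ≥0 in atTop, 0 < r := eventually_gt_atTop 0
  rw [charFun_gaussianReal]
  suffices h : Tendsto (fun r : ℝ≥0 => (r : ℂ) *
      (Complex.exp (((√(r : ℝ))⁻¹ * t : ℝ) * Complex.I) - 1 -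
        ((√(r : ℝ))⁻¹ * t : ℝ) * Complex.I)) atTop (𝓝 (-(t : ℂ) ^ 2 / 2)) by
    have h' := (Complex.continuous_exp.tendsto _).comp h
    refine (h'.congr' ?_).trans (by simp [neg_div])
    filter_upwards [hpos] with r hr
    exact (charFun_standardizedPoisson hr t).symm
  rcases eq_or_ne t 0 with rfl | ht
  · simp
  have hz : Tendsto (fun r : ℝ≥0 => (((√(r : ℝ))⁻¹ * t : ℝ) : ℂ) * Complex.I) atTop (𝓝[≠] 0) := by
    refine tendsto_nhdsWithin_iff.2 ⟨?_, ?_⟩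
    · have h0 : Tendsto (fun r : ℝ≥0 => (√(r : ℝ))⁻¹ * t) atTop (𝓝 0) := by
        simpa using tendsto_nnreal_sqrt_inv.mul_const t
      simpa using ((Complex.continuous_ofReal.tendsto _).comp h0).mul_const Complex.I
    · filter_upwards [hpos] with r hr
      have : √(r : ℝ) ≠ 0 := (Real.sqrt_pos.2 (by exact_mod_cast hr)).ne'
      simp [this, ht]
  have h := (tendsto_exp_sub_one_sub_self_div_sq.comp hz).const_mul (-(t : ℂ) ^ 2)
  rw [mul_one_div] at h
  refine h.congr' ?_
  filter_upwards [hpos] with r hr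
  have hr' : (0 : ℝ) < r := by exact_mod_cast hr
  have hsq : ((((√(r : ℝ))⁻¹ * t : ℝ) : ℂ) * Complex.I) ^ 2 = -(t : ℂ) ^ 2 / r := by
    rw [mul_pow, Complex.I_sq, ← Complex.ofReal_pow, mul_pow, inv_pow, Real.sq_sqrt hr'.le]
    push_cast
    have : ((r : ℝ) : ℂ) = (r : ℂ) := rfl
    rw [this]
    ring
  have hrc : (r : ℂ) ≠ 0 := by exact_mod_cast hr'.ne'
  have htc : (t : ℂ) ≠ 0 := by exact_mod_cast ht
  simp only [Function.comp, hsq]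
  field_simp

/-- The central limit theorem for Poisson variables of large mean. -/
lemma tendsto_standardizedPoisson :
    Tendsto standardizedPoisson atTop (𝓝 ⟨gaussianReal 0 1, inferInstance⟩) := by
  refine tendsto_of_seq_tendsto fun u hu => ?_
  exact ProbabilityMeasure.tendsto_of_tendsto_charFun fun t =>
    (tendsto_charFun_standardizedPoisson t).comp hu

/-! ### Expansion of the statistic around the common mean -/

/-- The continuous function with `u ^ 2 * entropyQuotient u = (1 + u) * log (1 + u) - u`. -/
noncomputable def entropyQuotient (u : ℝ) : ℝ :=
  if u = 0 then 1 / 2 else ((1 + u) * Real.log (1 + u) - u) / u ^ 2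

lemma sq_mul_entropyQuotient (u : ℝ) :
    u ^ 2 * entropyQuotient u = (1 + u) * Real.log (1 + u) - u := by
  rw [entropyQuotient]
  split_ifs with h
  · simp [h]
  · field_simp

lemma abs_entropyQuotient_sub_le {u : ℝ} (hu : |u| ≤ 1 / 2) :
    |entropyQuotient u - 1 / 2| ≤ 4 * |u| := by
  rcases eq_or_ne u 0 with rfl | h0
  · simp [entropyQuotient]
  have hlog := Real.abs_log_sub_add_sum_range_le (x := -u) (by rw [abs_neg]; linarith) 2
  simp only [Finset.sum_range_succ, Finset.sum_range_zero, abs_neg, sub_neg_eq_add] at hlog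
  norm_num at hlog
  set e := -u + u ^ 2 / 2 + Real.log (1 + u) with he
  have hu0 : 0 < |u| := abs_pos.2 h0
  have he' : |e| ≤ 2 * |u| ^ 3 := by
    refine hlog.trans ?_
    rw [div_le_iff₀ (by linarith)]
    nlinarith [pow_pos hu0 3]
  have heq : entropyQuotient u - 1 / 2 = (-u ^ 3 / 2 + (1 + u) * e) / u ^ 2 := by
    rw [entropyQuotient, if_neg h0, he]
    field_simp
    ring
  rw [heq, abs_div, abs_of_pos (by positivity : 0 < u ^ 2), div_le_iff₀ (by positivity)]
  have h1 : |1 + u| ≤ 3 / 2 := (abs_add_le _ _).trans (by rw [abs_one]; linarith)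
  calc |-u ^ 3 / 2 + (1 + u) * e| ≤ |-u ^ 3 / 2| + |(1 + u) * e| := abs_add_le _ _
    _ = |u| ^ 3 / 2 + |1 + u| * |e| := by simp [abs_div, abs_mul, abs_pow]
    _ ≤ |u| ^ 3 / 2 + 3 / 2 * (2 * |u| ^ 3) := by gcongr
    _ ≤ 4 * |u| ^ 3 := by linarith [pow_pos hu0 3]
    _ = 4 * |u| * u ^ 2 := by rw [← sq_abs u]; ring

lemma continuous_entropyQuotient : Continuous entropyQuotient := by
  rw [continuous_iff_continuousAt]
  intro u
  rcases eq_or_ne u 0 with rfl | h0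
  · have hval : entropyQuotient 0 = 1 / 2 := by simp [entropyQuotient]
    rw [ContinuousAt, hval, tendsto_iff_norm_sub_tendsto_zero]
    have hb : Tendsto (fun u : ℝ => 4 * |u|) (𝓝 0) (𝓝 0) := by
      have : Continuous fun u : ℝ => 4 * |u| := by fun_prop
      simpa using this.tendsto 0
    refine squeeze_zero' (Eventually.of_forall fun _ => norm_nonneg _) ?_ hb
    have h1 : ∀ᶠ u : ℝ in 𝓝 0, |u| < 1 / 2 := by
      have : Tendsto (fun u : ℝ => |u|) (𝓝 0) (𝓝 0) := by
        simpa using (continuous_abs.tendsto (0 : ℝ))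
      exact this.eventually_lt_const (by norm_num)
    filter_upwards [h1] with u hu using abs_entropyQuotient_sub_le hu.le
  · have hc : ContinuousAt (fun u : ℝ => ((1 + u) * Real.log (1 + u) - u) / u ^ 2) u := by
      -- Continuity of `x * log x` at `0` covers `u = -1`, a zero count.
      have h1 : Continuous fun u : ℝ => (1 + u) * Real.log (1 + u) :=
        Real.continuous_mul_log.comp (by fun_prop : Continuous fun u : ℝ => 1 + u)
      exact (h1.sub continuous_id).continuousAt.div (by fun_prop) (pow_ne_zero 2 h0)
    refine hc.congr ?_
    filter_upwards [isOpen_ne.mem_nhds h0] with v hv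
    rw [entropyQuotient, if_neg hv]

/-- The statistic in terms of the standardized counts `p.1 i` and of `p.2 = 1 / √r`, where `r` is
the common mean; at `p.2 = 0` this is the limiting quadratic form. -/
noncomputable def standardizedStat (P : ℕ) (p : (Fin P → ℝ) × ℝ) : ℝ :=
  2 * (∑ i, p.1 i ^ 2 * entropyQuotient (p.1 i * p.2) -
    (∑ i, p.1 i) ^ 2 / P * entropyQuotient ((∑ i, p.1 i) / P * p.2))

lemma continuous_standardizedStat (P : ℕ) : Continuous (standardizedStat P) := by
  have := continuous_entropyQuotient
  unfold standardizedStat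
  fun_prop

lemma standardizedStat_zero (P : ℕ) (z : Fin P → ℝ) :
    standardizedStat P (z, 0) = ∑ i, z i ^ 2 - (∑ i, z i) ^ 2 / P := by
  simp only [standardizedStat, mul_zero, entropyQuotient, if_true, ← Finset.sum_mul]
  ring

lemma sq_mul_entropyQuotient_standardized {r : ℝ} (hr : 0 < r) (s : ℝ) :
    ((√r)⁻¹ * s + -√r) ^ 2 * entropyQuotient (((√r)⁻¹ * s + -√r) * (√r)⁻¹) =
      s * Real.log s - s * Real.log r - s + r := by
  have hq : 0 < √r := Real.sqrt_pos.2 hr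
  have hu : ((√r)⁻¹ * s + -√r) * (√r)⁻¹ = s / r - 1 := by
    field_simp
    rw [Real.sq_sqrt hr.le]
    ring
  have hz : ((√r)⁻¹ * s + -√r) ^ 2 = r * (s / r - 1) ^ 2 := by
    rw [← hu, mul_pow, inv_pow, Real.sq_sqrt hr.le]
    field_simp
  rw [hu, hz, mul_assoc, sq_mul_entropyQuotient, add_sub_cancel]
  rcases eq_or_ne s 0 with rfl | hs
  · simp
  · rw [Real.log_div hs hr.ne']
    field_simp
    ring

/-- Apply the previous identity to each count and to the mean count `(∑ s i) / P`: the terms in `log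
r`, the linear terms and the constants cancel. -/
lemma standardizedStat_standardized {P : ℕ} (hP : 1 ≤ P) {r : ℝ} (hr : 0 < r) (s : Fin P → ℝ) :
    standardizedStat P (fun i => (√r)⁻¹ * s i + -√r, (√r)⁻¹) = countStat s := by
  have hP' : (0 : ℝ) < P := by exact_mod_cast hP
  have hmean : (∑ i, ((√r)⁻¹ * s i + -√r)) / P = (√r)⁻¹ * ((∑ i, s i) / P) + -√r := by
    rw [Finset.sum_add_distrib, ← Finset.mul_sum]
    simp only [Finset.sum_const, Finset.card_univ, Fintype.card_fin, nsmul_eq_mul]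
    field_simp
  have hsq : (∑ i, ((√r)⁻¹ * s i + -√r)) ^ 2 / P =
      P * ((√r)⁻¹ * ((∑ i, s i) / P) + -√r) ^ 2 := by
    rw [← hmean]
    field_simp
  simp only [standardizedStat, hmean, hsq, mul_assoc (P : ℝ),
    sq_mul_entropyQuotient_standardized hr]
  rw [countStat]
  simp only [Finset.sum_add_distrib, Finset.sum_sub_distrib, ← Finset.sum_mul, Finset.sum_const,
    Finset.card_univ, Fintype.card_fin, nsmul_eq_mul]
  rcases eq_or_ne (∑ i, s i) 0 with h0 | h0
  · simp [h0]
  · rw [Real.log_div h0 hP'.ne']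
    field_simp
    ring

/-! ### Convergence of the law of the statistic -/

/-- The law of the statistic when all total counts are Poisson of mean `r`. -/
noncomputable def nullLaw (P : ℕ) (r : ℝ≥0) : ProbabilityMeasure ℝ :=
  ⟨(Measure.pi fun _ : Fin P => poissonReal r).map countStat,
    Measure.isProbabilityMeasure_map measurable_countStat.aemeasurable⟩

/-- Carrying `1 / √r` as a Dirac factor makes the map independent of `r`, so the ordinary continuous
mapping theorem applies. -/
lemma nullLaw_eq {P : ℕ} (hP : 1 ≤ P) {r : ℝ≥0} (hr : 0 < r) :
    nullLaw P r = ((ProbabilityMeasure.pi fun _ : Fin P => standardizedPoisson r).prod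
      (diracProba (√(r : ℝ))⁻¹)).map (continuous_standardizedStat P).measurable.aemeasurable := by
  apply Subtype.ext
  have hm := (continuous_standardizedStat P).measurable
  change (Measure.pi fun _ => poissonReal r).map countStat =
    ((Measure.pi fun _ => (poissonReal r).map fun x => (√(r : ℝ))⁻¹ * x + -√(r : ℝ)).prod
      (Measure.dirac (√(r : ℝ))⁻¹)).map (standardizedStat P)
  rw [Measure.prod_dirac, Measure.map_map hm (by fun_prop),
    ← Measure.pi_map_pi (fun _ => Measurable.aemeasurable (by fun_prop)),
    Measure.map_map (by fun_prop) (by fun_prop)]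
  congr 1
  ext s
  exact (standardizedStat_standardized hP (by exact_mod_cast hr) s).symm

lemma tendsto_nullLaw (k : ℕ) :
    Tendsto (nullLaw (k + 1)) atTop (𝓝 ⟨chiSquared k, inferInstance⟩) := by
  have hcont := continuous_standardizedStat (k + 1)
  have hpi : Tendsto (fun r => ProbabilityMeasure.pi fun _ : Fin (k + 1) => standardizedPoisson r)
      atTop (𝓝 (ProbabilityMeasure.pi fun _ => ⟨gaussianReal 0 1, inferInstance⟩)) :=
    (ProbabilityMeasure.continuous_pi.tendsto _).comp
      (tendsto_pi_nhds.2 fun _ => tendsto_standardizedPoisson)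
  have hdirac := (continuous_diracProba.tendsto (0 : ℝ)).comp tendsto_nnreal_sqrt_inv
  have hprod := (ProbabilityMeasure.continuous_prod.tendsto _).comp (hpi.prodMk_nhds hdirac)
  have hmap := ProbabilityMeasure.tendsto_map_of_tendsto_of_continuous _ _ hprod hcont
  have hlim : ((ProbabilityMeasure.pi fun _ : Fin (k + 1) =>
      (⟨gaussianReal 0 1, inferInstance⟩ : ProbabilityMeasure ℝ)).prod (diracProba 0)).map
        hcont.measurable.aemeasurable = ⟨chiSquared k, inferInstance⟩ := by
    apply Subtype.ext
    change ((Measure.pi fun _ : Fin (k + 1) => gaussianReal 0 1).prod (Measure.dirac 0)).map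
      (standardizedStat (k + 1)) = chiSquared k
    rw [Measure.prod_dirac, Measure.map_map hcont.measurable (by fun_prop),
      ← map_sum_sq_sub_sq_sum_eq_chiSquared]
    congr 1
    ext z
    exact standardizedStat_zero _ z
  rw [← hlim]
  refine hmap.congr' ?_
  filter_upwards [eventually_gt_atTop 0] with r hr
  exact (nullLaw_eq (by omega) hr).symm

theorem theorem3p1 (P : ℕ) (hP : 1 ≤ P) :
    -- the law of `R` depends only on the products `μ i * M`
    (∀ (δ δ' : ℝ), 0 < δ → 0 < δ' →
      ∀ (M M' : ℕ), 1 ≤ M → 1 ≤ M' →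
      ∀ (μ μ' : Fin P → ℝ≥0), (∀ i, μ i * (M : ℝ≥0) = μ' i * (M' : ℝ≥0)) →
      ∀ (Ω Ω' : Type*) [MeasurableSpace Ω] [MeasurableSpace Ω']
        (ν : Measure Ω) (ν' : Measure Ω') [IsProbabilityMeasure ν] [IsProbabilityMeasure ν']
        (X : Fin M → Ω → Fin P → ℝ) (X' : Fin M' → Ω' → Fin P → ℝ),
        IsScaledPoissonSample ν δ μ X → IsScaledPoissonSample ν' δ' μ' X' →
        IdentDistrib (fun ω => lrtStat δ (fun m => X m ω))
          (fun ω => lrtStat δ' (fun m => X' m ω)) ν ν') ∧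
    -- under the null hypothesis, along any family of samples with `μc * M → ∞`
    -- (in particular with `M = 1` throughout)
    (∀ (δ : ℝ), 0 < δ →
      ∀ (ι : Type*) (l : Filter ι) (M : ι → ℕ) (μc : ι → ℝ≥0), (∀ j, 1 ≤ M j) →
        Tendsto (fun j => μc j * (M j : ℝ≥0)) l atTop →
      ∀ (Ω : ι → Type*) [∀ j, MeasurableSpace (Ω j)] (ν : ∀ j, Measure (Ω j))
        [∀ j, IsProbabilityMeasure (ν j)] (X : ∀ j, Fin (M j) → Ω j → Fin P → ℝ),
        (∀ j, IsScaledPoissonSample (ν j) δ (fun _ => μc j) (X j)) →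
        -- `R` converges in distribution to `χ²` with `P - 1` degrees of freedom
        TendstoInDistribution (fun j ω => lrtStat δ (fun m => X j m ω)) l
          (id : ℝ → ℝ) ν (chiSquared (P - 1)) ∧
        -- and the test that rejects when `R` exceeds the upper `α` point of `χ²` has
        -- asymptotic level `α`
        (∀ (α c : ℝ), 0 < α → α < 1 → (chiSquared (P - 1)).real (Set.Ioi c) = α →
          Tendsto (fun j => (ν j).real {ω | c < lrtStat δ (fun m => X j m ω)}) l (𝓝 α))) := by
  refine ⟨?_, ?_⟩
  · intro δ δ' hδ hδ' M M' hM hM' μ μ' hμ Ω Ω' _ _ ν ν' _ _ X X' hX hX'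
    have h := hX.hasLaw_lrtStat hδ hM hP
    have h' := hX'.hasLaw_lrtStat hδ' hM' hP
    refine ⟨h.aemeasurable, h'.aemeasurable, ?_⟩
    rw [h.map_eq, h'.map_eq]
    simp only [hμ]
  · intro δ hδ ι l M μc hM hlim Ω _ ν _ X hX
    obtain ⟨k, rfl⟩ : ∃ k, P = k + 1 := ⟨P - 1, by omega⟩
    have hlaw j := (hX j).hasLaw_lrtStat hδ (hM j) hP
    have ht := (tendsto_nullLaw k).comp hlim
    have hdist : TendstoInDistribution (fun j ω => lrtStat δ (fun m => X j m ω)) l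
        (id : ℝ → ℝ) ν (chiSquared k) := by
      refine ⟨fun j => (hlaw j).aemeasurable, aemeasurable_id, ?_⟩
      have hid : (⟨(chiSquared k).map id, Measure.isProbabilityMeasure_map aemeasurable_id⟩ :
          ProbabilityMeasure ℝ) = ⟨chiSquared k, inferInstance⟩ := Subtype.ext Measure.map_id
      rw [hid]
      exact ht.congr fun j => Subtype.ext (hlaw j).map_eq.symm
    refine ⟨hdist, fun α c hα hα1 hc => ?_⟩
    -- For `k = 0` the limit is a point mass, whose tails are `0` or `1`, never `α`.
    have hk : k ≠ 0 := by
      rintro rfl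
      have h0 : chiSquared 0 = Measure.dirac 0 := by simp [chiSquared]
      rw [Nat.add_sub_cancel, h0, measureReal_def,
        Measure.dirac_apply' _ measurableSet_Ioi] at hc
      by_cases h : (0 : ℝ) ∈ Set.Ioi c
      · simp only [Set.indicator_of_mem h, Pi.one_apply, ENNReal.toReal_one] at hc
        linarith
      · simp only [Set.indicator_of_notMem h, ENNReal.toReal_zero] at hc
        linarith
    obtain ⟨n, rfl⟩ := Nat.exists_eq_succ_of_ne_zero hk
    have hfr : chiSquared (n + 1) (frontier (Set.Ioi c)) = 0 := by
      rw [frontier_Ioi, chiSquared_succ_singleton]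
    have hport := ProbabilityMeasure.tendsto_measure_of_null_frontier_of_tendsto' ht hfr
    rw [← hc]
    refine ((ENNReal.tendsto_toReal (measure_ne_top (chiSquared (n + 1)) _)).comp hport).congr
      fun j => ?_
    exact ((hlaw j).measureReal_eq (p := fun x => c < x) measurableSet_Ioi).symm
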